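/- Let $q$ be an odd prime, $m\ge 2$ even, $\mathrm{Tr}:\mathbb{F}_{q^m}\to\mathbb{F}_q$ the trace, $\mathcal{R}=\mathbb{F}_q+u\mathbb{F}_q$ and $\mathcal{R}_m=\mathbb{F}_{q^m}+u\mathbb{F}_{q^m}$ with $u^2=1$, and $\mathrm{tr}(r+us)=\mathrm{Tr}(r)+u\,\mathrm{Tr}(s)$ from $\mathcal{R}_m$ onto $\mathcal{R}$. Let $$D=\{a+ub\in\mathcal{R}_m\setminus\{0\}:\ \mathrm{tr}(a^2+ub^2)=0\}=\{d_1,\dots,d_n\},\qquad \mathcal{C}_D=\{(\mathrm{tr}(xd_1),\dots,\mathrm{tr}(xd_n)):x\in\mathcal{R}_m\}\subseteq\mathcal{R}^n .$$ The Gray map $\phi:\mathcal{R}^n\to\mathbb{F}_q^{2n}$ sends $r+us$ to $(r,s)$ for $r,s\in\mathbb{F}_q^n$, and the Lee weight of a word is the Hamming weight of its Gray image. For a code $\mathcal{C}\subseteq\mathbb{F}_q^{N}$, with variables $w_0,\dots,w_{q-1}$ attached to the elements of $\mathbb{F}_q$ ($w_0$ to the element $0$), the complete weight enumerator is $\sum_{c\in\mathcal{C}}\prod_j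 w_j^{n_j(c)}$, where $n_j(c)$ is the number of coordinates of $c$ equal to the $j$-th element. Put $$G=-(-1)^{\frac{(q-1)^2m}{8}}q^{\frac m2},\quad P_2=2q^{2m-3}+4G(q-1)q^{m-3},\quad Q_2=(q-1)(q^{m-1}-q^{-1}G),$$ $$P_3=q^{m-1}+q^{-1}(q-1)G,\quad Q_3=2(q-1)q^{m-2}.$$ The length of $\mathcal{C}_D$ is $n=(q^{m-1}+q^{-1}(q-1)G)^2-1$. Moreover, if $D\neq\emptyset$, then the following hold. (1) $\mathcal{C}_D$ is a free $\mathcal{R}$-module of rank $m$. (2) $\mathcal{C}_D$ has exactly one codeword of Lee weight $0$ and exactly five nonzero Lee weights; these are the following five pairwise distinct positive integers, attained with the following positive multiplicities: | Weight | Multiplicity | |---|---| | $2(q-1)q^{2m-3}+2G(q-1)^2q^{m-3}$ | $2(q^{m-1}+q^{-1}(q-1)G-1)$ | | $2(q-1)q^{2m-3}+2G(q-1)(2q-1)q^{m-3}+2(q-1)^2q^{m-2}$ | $2(q-1)(q^{m-1}-q^{-1}G)$ | | $2(q-1)q^{2m-3}+4G(q-1)^2q^{m-3}$ | $(q^{m-1}+q^{-1}(q-1)G-1)^2$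 | | $2(q-1)q^{2m-3}+4G(q-1)^2q^{m-3}+2(q-1)^2q^{m-2}$ | $2(q-1)(q^{m-1}-q^{-1}G)(q^{m-1}+q^{-1}(q-1)G-1)$ | | $2(q-1)q^{2m-3}+4G(q-1)^2q^{m-3}+2(q-1)(q-2)q^{m-2}$ | $(q-1)^2(q^{m-1}-q^{-1}G)^2$ | (3) The complete weight enumerator of $\phi(\mathcal{C}_D)$ is $$\begin{aligned}&w_0^{2P_3^2-2}+2(P_3-1)\,w_0^{P_2+Q_3(q-1)(q+G)q^{-1}-2}\prod_{i=1}^{q-1}w_i^{P_2-Q_3q^{-1}G}\\&+2Q_2\,w_0^{P_2-Q_3q^{-1}G-2}\prod_{i=1}^{q-1}w_i^{P_2+Q_3+2Gq^{m-3}}+(P_3-1)^2\,w_0^{P_2+(q-1)Q_3-2}\prod_{i=1}^{q-1}w_i^{P_2}\\&+2Q_2(P_3-1)\,w_0^{P_2-2}\prod_{i=1}^{q-1}w_i^{P_2+Q_3}+Q_2^2\,w_0^{P_2+Q_3-2}\prod_{i=1}^{q-1}w_i^{P_2+2(q-2)q^{m-2}},\end{aligned}$$ where all the exponents are nonnegative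 integers. -/

import Mathlib

namespace LeeCode

/-- The ring `A + uA` with `u² = 1`; the element `r + us` has `re = r` and `im = s`. -/
abbrev Ru (A : Type*) [CommRing A] : Type _ := QuadraticAlgebra A (1 : A) (0 : A)

section Trace

variable (F K : Type*) [Field F] [Field K] [Algebra F K]

/-- The inclusion of `F + uF` in `K + uK`. -/
def incl (r : Ru F) : Ru K := ⟨algebraMap F K r.re, algebraMap F K r.im⟩

/-- The trace `K + uK → F + uF`, `tr (r + us) = Tr r + u Tr s`, with `Tr` the trace of `K` over `F`.
See `incl_tr` for its expression by powers of the Frobenius operator. -/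
noncomputable def tr (x : Ru K) : Ru F := ⟨Algebra.trace F K x.re, Algebra.trace F K x.im⟩

theorem tr_add (x y : Ru K) : tr F K (x + y) = tr F K x + tr F K y := by
  ext <;> simp [tr]

theorem tr_incl_mul (r : Ru F) (x : Ru K) : tr F K (incl F K r * x) = r * tr F K x := by
  ext <;> simp [tr, incl, ← Algebra.smul_def]

/-- The Frobenius operator `r + us ↦ r^q + u s^q` of `K + uK`. -/
def frob (q : ℕ) (x : Ru K) : Ru K := ⟨x.re ^ q, x.im ^ q⟩

/-- `tr = ∑_{j < m} frob^j`, where `m` is the degree of `K` over `F` and `q = #F`. -/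
theorem incl_tr [Fintype F] [Finite K] (x : Ru K) :
    incl F K (tr F K x) =
      ∑ j ∈ Finset.range (Module.finrank F K), (frob K (Fintype.card F))^[j] x := by
  have hit : ∀ j : ℕ, (frob K (Fintype.card F))^[j] x =
      ⟨x.re ^ (Fintype.card F) ^ j, x.im ^ (Fintype.card F) ^ j⟩ := by
    intro j
    induction j with
    | zero => simp
    | succ k ih => rw [Function.iterate_succ_apply', ih]; simp [frob, pow_succ, pow_mul]
  have hsum : ∀ n : ℕ, (∑ j ∈ Finset.range n, (frob K (Fintype.card F))^[j] x) =
      ⟨∑ j ∈ Finset.range n, x.re ^ (Fintype.card F) ^ j,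
        ∑ j ∈ Finset.range n, x.im ^ (Fintype.card F) ^ j⟩ := by
    intro n
    induction n with
    | zero => rfl
    | succ k ih =>
      rw [Finset.sum_range_succ, ih, hit, Finset.sum_range_succ, Finset.sum_range_succ]
      rfl
  rw [hsum]
  ext <;> simp [incl, tr, FiniteField.algebraMap_trace_eq_sum_pow, Nat.card_eq_fintype_card]

/-- The defining set `D = {a + ub ≠ 0 : tr (a² + u b²) = 0}`. -/
def definingSet : Set (Ru K) := {d | d ≠ 0 ∧ tr F K ⟨d.re ^ 2, d.im ^ 2⟩ = 0}

instance finite_Ru [Finite K] : Finite (Ru K) :=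
  Finite.of_equiv _ (QuadraticAlgebra.equivProd (1 : K) (0 : K)).symm

noncomputable instance fintype_definingSet [Finite K] : Fintype (definingSet F K) :=
  Fintype.ofFinite _

/-- The word `(tr (x d))_{d ∈ D}`; coordinates are indexed by `D` itself. -/
noncomputable def codeword (x : Ru K) : definingSet F K → Ru F := fun d => tr F K (x * d)

/-- The linear code `C_D = {(tr (x d))_{d ∈ D} : x ∈ K + uK}` over the ring `F + uF`. -/
noncomputable def code : Submodule (Ru F) (definingSet F K → Ru F) where
  carrier := Set.range (codeword F K)
  zero_mem' := ⟨0, by funext d; ext <;> simp [codeword, tr]⟩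
  add_mem' := by
    rintro _ _ ⟨x, rfl⟩ ⟨y, rfl⟩
    exact ⟨x + y, by funext d; simp [codeword, add_mul, tr_add]⟩
  smul_mem' := by
    rintro r _ ⟨x, rfl⟩
    exact ⟨incl F K r * x, by funext d; simp [codeword, mul_assoc, tr_incl_mul]⟩

end Trace

section Weights

variable {F ι : Type*} [Field F]

/-- The Gray map `(F + uF)^ι → F^(2ι)`, `r + us ↦ (r, s)`. -/
def gray : (ι → Ru F) →ₗ[F] (ι ⊕ ι → F) where
  toFun c := Sum.elim (fun i => (c i).re) (fun i => (c i).im)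
  map_add' x y := by funext i; cases i <;> simp
  map_smul' r x := by funext i; cases i <;> simp

/-- The Gray image `φ(C)`, a linear code over `F`. -/
def grayImage (C : Submodule (Ru F) (ι → Ru F)) : Submodule F (ι ⊕ ι → F) :=
  (C.restrictScalars F).map gray

/-- The Lee weight of a word: the Hamming weight of its Gray image. -/
def leeWeight [Fintype ι] [DecidableEq F] (c : ι → Ru F) : ℕ := hammingNorm (gray c)

/-- The number of codewords of Lee weight `w`. -/
noncomputable def leeCount [Fintype ι] [DecidableEq F] (C : Submodule (Ru F) (ι → Ru F)) (w : ℕ) :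
    ℕ :=
  {c : ι → Ru F | c ∈ C ∧ leeWeight c = w}.ncard

/-- The composition of a word: the number of coordinates equal to the symbol `s`. -/
def comp [Fintype ι] [DecidableEq F] (c : ι → F) (s : F) : ℕ :=
  (Finset.univ.filter fun i => c i = s).card

open Classical in
/-- The complete weight enumerator `∑_{c ∈ C} ∏_{s ∈ F} w_s ^ {comp c s}`, with one variable
`w_s = X s` for each symbol `s ∈ F`. -/
noncomputable def completeWeightEnumerator [Fintype F] [Fintype ι] (C : Submodule F (ι → F)) :
    MvPolynomial F ℚ :=
  ∑ c : ι → F with c ∈ C, ∏ s : F, MvPolynomial.X s ^ comp c s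

end Weights

end LeeCode

/-! Write x = α + uβ and d = a + ub. The trace acts coordinatewise, so d lies in D exactly when d ≠
0 and Tr(a²) = Tr(b²) = 0, while tr(xd) has coordinates Tr(αa + βb) and Tr(αb + βa). Swapping a and
b preserves D, so both halves of the Gray image have the same composition, and that composition is a
convolution of the counts N(α, t) of a with Tr(a²) = 0 and Tr(αa) = t (`comp_gray_codeword`,
`card_isotropicPairs_eq`).

Orthogonality of characters reduces N(α, t) to the sums Σ ψ(y Tr(x²)), y ≠ 0. As m is even, K is
quadratic over a subfield L, its trace form over L is diagonal, and the sum is a product of two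
quadratic Gauss sums over L; it equals G for every y (`sum_traceChar_mul_sq`). Hence N(α, t) depends
only on whether t = 0 and on whether α = 0, or else whether Tr(α²) = 0 (`isotropicCount_eq`).
Unordered pairs of these three types give six classes of x, the six terms of the enumerator.

With r = q^(m/2 - 1) and G = εqr, ε = ±1, every quantity is a polynomial in q, r, ε. The six weights
are distinct (`symbolRate_injective`) unless ε = -1 and m = 2, which is when D is empty.
Distinctness makes x = 0 the only message of weight zero, so x ↦ codeword is injective; freeness
follows, and the multiplicities are the class sizes. -/

namespace LeeCode

/-! ### Quadratic Gauss sums over extensions of even degree. -/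

section GaussSums

open Finset

/-- The additive character `ψ ∘ Tr` of a field extension. -/
noncomputable def traceChar {F : Type*} (K : Type*) [Field F] [Field K] [Algebra F K]
    (ψ : AddChar F ℂ) : AddChar K ℂ :=
  ψ.compAddMonoidHom (Algebra.trace F K).toAddMonoidHom

@[simp]
theorem traceChar_apply {F K : Type*} [Field F] [Field K] [Algebra F K]
    (ψ : AddChar F ℂ) (x : K) : traceChar K ψ x = ψ (Algebra.trace F K x) := rfl

theorem traceChar_isPrimitive {F K : Type*} [Field F] [Field K] [Finite K] [Algebra F K]
    {ψ : AddChar F ℂ} (hψ : ψ.IsPrimitive) : (traceChar K ψ).IsPrimitive := by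
  have : Finite F := Finite.of_injective _ (algebraMap F K).injective
  apply AddChar.IsPrimitive.of_ne_one
  have h1 : ψ ≠ 1 := by
    have := hψ one_ne_zero
    rwa [AddChar.mulShift_one] at this
  obtain ⟨a, ha⟩ := AddChar.ne_one_iff.mp h1
  obtain ⟨x, hx⟩ := Algebra.trace_surjective F K a
  exact AddChar.ne_one_iff.mpr ⟨x, by rwa [traceChar_apply, hx]⟩

theorem mulShift_isPrimitive {L : Type*} [Field L] {ψ : AddChar L ℂ} (hψ : ψ.IsPrimitive)
    {c : L} (hc : c ≠ 0) : (ψ.mulShift c).IsPrimitive := by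
  intro a ha
  rw [AddChar.mulShift_mulShift]
  exact hψ (mul_ne_zero hc ha)

/-- The complex valued quadratic character of a finite field. -/
noncomputable def quadChar (L : Type*) [Field L] [Fintype L] [DecidableEq L] : MulChar L ℂ :=
  (quadraticChar L).ringHomComp (Int.castRingHom ℂ)

theorem quadChar_apply {L : Type*} [Field L] [Fintype L] [DecidableEq L] (a : L) : quadChar L a = ((quadraticChar L a : ℤ) : ℂ) := rfl

variable {L : Type*} [Field L] [Fintype L]

theorem ringChar_ne_two_of_odd {L : Type*} [Field L] {q : ℕ} [Fact q.Prime] (hq : Odd q)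
    [Algebra (ZMod q) L] : ringChar L ≠ 2 := by
  rw [← Algebra.ringChar_eq (ZMod q) L, ZMod.ringChar_zmod_n]
  rintro rfl
  exact absurd hq (by decide)

/-- A quadratic extension of finite fields is generated by a square root of a nonsquare, which is
negated by the Frobenius and so has trace zero. -/
theorem exists_sqrt_nonsquare (K : Type*) [Field K] [Finite K] [Algebra L K]
    (h2 : Module.finrank L K = 2) (hL : ringChar L ≠ 2) :
    ∃ (d : L) (s : K), ¬ IsSquare d ∧ s ^ 2 = algebraMap L K d ∧ Algebra.trace L K s = 0 := by
  have := Fintype.ofFinite K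
  obtain ⟨d, hd⟩ := FiniteField.exists_nonsquare hL
  have hd0 : d ≠ 0 := by rintro rfl; exact hd (IsSquare.zero)
  have hodd : Fintype.card L % 2 = 1 := FiniteField.odd_card_of_char_ne_two hL
  have hdp : d ^ (Fintype.card L / 2) = -1 := by
    rcases FiniteField.pow_dichotomy hL hd0 with h | h
    · exact absurd ((FiniteField.isSquare_iff hL hd0).mpr h) hd
    · exact h
  have hcard : Fintype.card K = Fintype.card L ^ 2 := by
    rw [← h2]; exact Module.card_eq_pow_finrank
  have hK : ringChar K ≠ 2 := by
    rwa [← Algebra.ringChar_eq L K]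
  have hsq : IsSquare (algebraMap L K d) := by
    rw [FiniteField.isSquare_iff hK (by simpa using hd0), ← map_pow]
    obtain ⟨j, hj⟩ : ∃ j, Fintype.card L = 2 * j + 1 := ⟨Fintype.card L / 2, by omega⟩
    have hj' : Fintype.card L / 2 = j := by omega
    -- Euler's criterion in K: the exponent (|K| - 1)/2 is an even multiple of (|L| - 1)/2 = j, and
    -- d ^ j = -1.
    have e1 : Fintype.card K / 2 = j * 2 * (j + 1) := by
      rw [hcard, hj]
      have : (2 * j + 1) ^ 2 = 2 * (j * 2 * (j + 1)) + 1 := by ring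
      omega
    rw [e1, pow_mul, pow_mul, ← hj', hdp]
    simp
  obtain ⟨s, hs⟩ := hsq
  refine ⟨d, s, hd, by rw [sq, ← hs], ?_⟩
  apply (algebraMap L K).injective
  rw [FiniteField.algebraMap_trace_eq_sum_pow, h2, Nat.card_eq_fintype_card]
  have hsp : s ^ Fintype.card L = -s := by
    have : Fintype.card L = 2 * (Fintype.card L / 2) + 1 := by omega
    rw [this, pow_succ, pow_mul, sq, ← hs, ← map_pow, hdp]
    simp
  simp [Finset.sum_range_succ, hsp]

variable [DecidableEq L]

/-- The fibre of squaring over t has 1 + η(t) elements, η the quadratic character, and the sum of ψ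
alone vanishes. -/
theorem sum_addChar_sq (hL : ringChar L ≠ 2) {ψ : AddChar L ℂ} (hψ : ψ.IsPrimitive) :
    ∑ a : L, ψ (a ^ 2) = gaussSum (quadChar L) ψ := by
  have h1 : ∑ a : L, ψ (a ^ 2) = ∑ t : L, ((quadraticChar L t : ℤ) + 1 : ℂ) * ψ t := by
    rw [← Finset.sum_fiberwise (s := univ) (g := fun a : L => a ^ 2)]
    refine Finset.sum_congr rfl fun t _ => ?_
    have h2 : ∀ a ∈ univ.filter (fun a : L => a ^ 2 = t), ψ (a ^ 2) = ψ t := by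
      intro a ha
      rw [(Finset.mem_filter.mp ha).2]
    rw [Finset.sum_congr rfl h2, Finset.sum_const, nsmul_eq_mul]
    congr 1
    have h3 := quadraticChar_card_sqrts hL t
    rw [Set.toFinset_ofPred] at h3
    exact_mod_cast congrArg (Int.cast : ℤ → ℂ) h3
  have h0 : ∑ t : L, ψ t = 0 := by
    apply AddChar.sum_eq_zero_of_ne_one
    have := hψ one_ne_zero
    rwa [AddChar.mulShift_one] at this
  rw [h1]
  simp only [add_mul, one_mul, Finset.sum_add_distrib, h0, add_zero]
  rfl

theorem sum_addChar_mul_sq (hL : ringChar L ≠ 2) {ψ : AddChar L ℂ} (hψ : ψ.IsPrimitive)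
    {c : L} (hc : c ≠ 0) :
    ∑ a : L, ψ (c * a ^ 2) = quadChar L c * gaussSum (quadChar L) ψ := by
  have h1 := sum_addChar_sq hL (mulShift_isPrimitive hψ hc)
  simp only [AddChar.mulShift_apply] at h1
  rw [h1, ← gaussSum_mulShift (quadChar L) ψ (Units.mk0 c hc), Units.val_mk0, ← mul_assoc]
  have h2 : quadChar L c * quadChar L c = 1 := by
    rw [quadChar_apply, ← sq]
    exact_mod_cast quadraticChar_sq_one hc
  rw [h2, one_mul]

theorem quadChar_ne_one (hL : ringChar L ≠ 2) : quadChar L ≠ 1 := by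
  obtain ⟨a, ha⟩ := quadraticChar_exists_neg_one' hL
  intro h
  have h1 : quadChar L (a : L) = 1 := by rw [h, MulChar.one_apply_coe]
  rw [quadChar_apply, ha] at h1
  norm_num at h1

theorem quadChar_isQuadratic : (quadChar L).IsQuadratic := by
  intro a
  rcases quadraticChar_isQuadratic L a with h | h | h <;> simp [quadChar_apply, h]

/-- The quadratic Gauss sum of a quadratic extension of finite fields. -/
theorem sum_traceChar_sq_of_finrank_two (K : Type*) [Field K] [Fintype K] [Algebra L K]
    (h2 : Module.finrank L K = 2) (hL : ringChar L ≠ 2) {ψ : AddChar L ℂ} (hψ : ψ.IsPrimitive) :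
    ∑ x : K, ψ (Algebra.trace L K (x ^ 2)) =
      -(quadChar L (-1) * (Fintype.card L : ℂ)) := by
  obtain ⟨d, s, hd, hs, hts⟩ := exists_sqrt_nonsquare (L := L) K h2 hL
  have hd0 : d ≠ 0 := by rintro rfl; exact hd (IsSquare.zero)
  have hcard : Fintype.card K = Fintype.card L ^ 2 := by
    rw [← h2]; exact Module.card_eq_pow_finrank
  let f : L × L → K := fun p => algebraMap L K p.1 + algebraMap L K p.2 * s
  have hf : Function.Bijective f := by
    rw [Fintype.bijective_iff_injective_and_card]
    refine ⟨?_, by rw [Fintype.card_prod, hcard, sq]⟩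
    rintro ⟨a, b⟩ ⟨a', b'⟩ h
    have h' : algebraMap L K (a - a') = algebraMap L K (b' - b) * s := by
      simp only [f] at h
      simp only [map_sub]
      linear_combination h
    -- Otherwise s would lie in L, and d = s² would be a square there.
    have hb : b' - b = 0 := by
      by_contra hb
      apply hd
      refine ⟨(a - a') / (b' - b), ?_⟩
      apply (algebraMap L K).injective
      have hb' : algebraMap L K (b' - b) ≠ 0 := (map_ne_zero _).mpr hb
      rw [← hs, map_mul, map_div₀, h']
      field_simp
    rw [hb, map_zero, zero_mul, map_eq_zero] at h'
    rw [Prod.mk.injEq]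
    exact ⟨sub_eq_zero.mp h', (sub_eq_zero.mp hb).symm⟩
  have htr : ∀ p : L × L, Algebra.trace L K (f p ^ 2) = 2 * p.1 ^ 2 + 2 * d * p.2 ^ 2 := by
    intro p
    have : f p ^ 2 = algebraMap L K (p.1 ^ 2 + d * p.2 ^ 2) + (2 * p.1 * p.2) • s := by
      simp only [f, Algebra.smul_def, map_add, map_mul, map_pow, ← hs, map_ofNat]
      ring
    rw [this, map_add, map_smul, hts, Algebra.trace_algebraMap, h2]
    simp only [smul_zero, nsmul_eq_mul, Nat.cast_ofNat]
    ring
  have h20 : (2 : L) ≠ 0 := Ring.two_ne_zero hL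
  rw [← hf.sum_comp, Fintype.sum_prod_type]
  simp only [htr, AddChar.map_add_eq_mul]
  -- In the basis 1, s the form is 2a² + 2db², so the sum is η(2)η(2d)g² = η(d)g² = -g². Only g² =
  -- η(-1)|L| enters, never the sign of g itself.
  rw [← Finset.sum_mul_sum, sum_addChar_mul_sq hL hψ h20,
    sum_addChar_mul_sq hL hψ (mul_ne_zero h20 hd0), map_mul]
  have hg := gaussSum_sq (quadChar_ne_one hL) quadChar_isQuadratic hψ
  have e1 : quadChar L 2 ^ 2 = 1 := by
    rw [quadChar_apply]; exact_mod_cast quadraticChar_sq_one h20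
  have e2 : quadChar L d = -1 := by
    rw [quadChar_apply, quadraticChar_neg_one_iff_not_isSquare.mpr hd]; simp
  rw [e2, ← hg]
  linear_combination (-gaussSum (quadChar L) ψ ^ 2) * e1

/-- Here 2k plays the role of m. For q = 2j + 1 the exponent is j²k, which is odd exactly when j and
k are both odd, that is, when q ^ k ≡ 3 mod 4. -/
theorem quadChar_neg_one {q k : ℕ} (hq : Odd q) (hL : ringChar L ≠ 2)
    (hcard : Fintype.card L = q ^ k) :
    quadChar L (-1) = (-1) ^ ((q - 1) ^ 2 * (2 * k) / 8) := by
  obtain ⟨j, rfl⟩ := hq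
  have e1 : (2 * j + 1 - 1) ^ 2 * (2 * k) / 8 = j ^ 2 * k := by
    have : (2 * j + 1 - 1) ^ 2 * (2 * k) = 8 * (j ^ 2 * k) := by
      rw [Nat.add_sub_cancel]; ring
    omega
  have e2 : ∀ k, ((2 * j + 1) ^ k : ℕ) % 4 = if Even (j ^ 2 * k) then 1 else 3 := by
    intro k
    induction k with
    | zero => simp
    | succ k ih =>
      rw [pow_succ, Nat.mul_mod, ih]
      rcases Nat.even_or_odd' j with ⟨i, rfl | rfl⟩
      · have : (2 * (2 * i) + 1) % 4 = 1 := by omega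
        simp [this, parity_simps]
      · have : (2 * (2 * i + 1) + 1) % 4 = 3 := by omega
        by_cases hk : Even k <;> simp [this, hk, parity_simps]
  rw [quadChar_apply, quadraticChar_neg_one hL, hcard, e1, ZMod.χ₄_nat_mod_four, e2]
  by_cases h : Even (j ^ 2 * k)
  · rw [if_pos h, h.neg_one_pow]
    have : ZMod.χ₄ ((1 : ℕ) : ZMod 4) = 1 := rfl
    rw [this]
    simp
  · rw [if_neg h, (Nat.not_even_iff_odd.mp h).neg_one_pow]
    have : ZMod.χ₄ ((3 : ℕ) : ZMod 4) = -1 := rfl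
    rw [this]
    simp

/-- The quadratic Gauss sum of an extension of even degree of the prime field. -/
theorem sum_traceChar_mul_sq {q m : ℕ} [Fact q.Prime] (hq : Odd q) (hm : m ≠ 0) (hme : Even m)
    (K : Type*) [Field K] [Fintype K] [Algebra (ZMod q) K] (hK : Nat.card K = q ^ m)
    {ψ : AddChar (ZMod q) ℂ} (hψ : ψ.IsPrimitive) {y : ZMod q} (hy : y ≠ 0) :
    ∑ x : K, ψ (y * Algebra.trace (ZMod q) K (x ^ 2)) =
      -(-1) ^ ((q - 1) ^ 2 * m / 8) * (q : ℂ) ^ (m / 2) := by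
  classical
  obtain ⟨k, rfl⟩ := hme
  have hk : k ≠ 0 := by omega
  have hfr : Module.finrank (ZMod q) K = k + k := by
    have h1 := FiniteField.pow_finrank_eq_natCard q K
    rw [hK] at h1
    exact Nat.pow_right_injective (Fact.out : q.Prime).two_le h1
  let L := GaloisField q k
  have hLc : Nat.card L = q ^ k := GaloisField.card q k hk
  have hLf : Module.finrank (ZMod q) L = k := GaloisField.finrank q hk
  have : Finite L := Nat.finite_of_card_ne_zero (by
    rw [hLc]; exact pow_ne_zero _ (Fact.out : q.Prime).ne_zero)
  have := Fintype.ofFinite L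
  obtain ⟨i⟩ := FiniteField.nonempty_algHom_of_finrank_dvd (F := ZMod q) (K := L) (L := K)
    (by rw [hLf, hfr]; exact ⟨2, by ring⟩)
  let _ : Algebra L K := i.toRingHom.toAlgebra
  have : IsScalarTower (ZMod q) L K := IsScalarTower.of_algebraMap_eq fun x => (i.commutes x).symm
  have hL : ringChar L ≠ 2 := ringChar_ne_two_of_odd hq
  have h2 : Module.finrank L K = 2 := by
    have h := Module.finrank_mul_finrank (ZMod q) L K
    rw [hLf, hfr] at h
    have : k * Module.finrank L K = k * 2 := by omega
    exact Nat.eq_of_mul_eq_mul_left (Nat.pos_of_ne_zero hk) this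
  -- The factor y is absorbed into the character; the quadratic-extension formula does not see which
  -- primitive character is used, so y drops out.
  have key := sum_traceChar_sq_of_finrank_two K h2 hL
    (traceChar_isPrimitive (K := L) (mulShift_isPrimitive hψ hy))
  simp only [traceChar_apply, Algebra.trace_trace, AddChar.mulShift_apply] at key
  rw [Nat.card_eq_fintype_card] at hLc
  rw [key, quadChar_neg_one hq hL hLc, hLc, show (k + k) / 2 = k by omega, ← two_mul]
  push_cast
  ring

end GaussSums

/-! ### Counting isotropic elements on hyperplanes by orthogonality. -/

section Counts

open Finset

variable {F K : Type*} [Field F] [DecidableEq F] [Field K] [Fintype K] [Algebra F K]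

/-- The number of `a` with `Tr (a²) = 0` and `Tr (α a) = t`. -/
noncomputable def isotropicCount (F : Type*) {K : Type*} [Field F] [DecidableEq F] [Field K] [Fintype K]
    [Algebra F K] (α : K) (t : F) : ℕ :=
  #{a : K | Algebra.trace F K (a ^ 2) = 0 ∧ Algebra.trace F K (α * a) = t}

/-- The number of `a` with `Tr (a²) = 0`. -/
noncomputable def isotropicCard (F K : Type*) [Field F] [DecidableEq F] [Field K] [Fintype K]
    [Algebra F K] : ℕ :=
  #{a : K | Algebra.trace F K (a ^ 2) = 0}

theorem isotropicCount_zero (t : F) :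
    isotropicCount F (0 : K) t = if t = 0 then isotropicCard F K else 0 := by
  unfold isotropicCount isotropicCard
  split_ifs with h
  · simp [h]
  · simp [Ne.symm h]

variable [Fintype F]

theorem sum_addChar_mul {ψ : AddChar F ℂ} (hψ : ψ.IsPrimitive) (b : F) :
    ∑ y : F, ψ (y * b) = if b = 0 then (Fintype.card F : ℂ) else 0 := by
  rw [AddChar.sum_mulShift b hψ]
  split_ifs <;> simp

theorem sum_addChar_mul_trace {F K : Type*} [Field F] [Field K] [Fintype K] [Algebra F K]
    {ψ : AddChar F ℂ} (hψ : ψ.IsPrimitive) [DecidableEq K] (α : K) :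
    ∑ a : K, ψ (Algebra.trace F K (α * a)) = if α = 0 then (Fintype.card K : ℂ) else 0 := by
  rw [← sum_addChar_mul (traceChar_isPrimitive (K := K) hψ) α]
  simp [mul_comm]

variable {ψ : AddChar F ℂ} {g : ℂ}

/-- Summing ψ(y Tr(a²)) over y detects Tr(a²) = 0; y = 0 contributes |K| and every other y
contributes g. -/
theorem card_mul_isotropicCard (hψ : ψ.IsPrimitive)
    (hg : ∀ y : F, y ≠ 0 → ∑ x : K, ψ (y * Algebra.trace F K (x ^ 2)) = g) :
    (Fintype.card F : ℂ) * isotropicCard F K =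
      Fintype.card K + (Fintype.card F - 1) * g := by
  have h1 : (Fintype.card F : ℂ) * isotropicCard F K =
      ∑ y : F, ∑ a : K, ψ (y * Algebra.trace F K (a ^ 2)) := by
    rw [Finset.sum_comm]
    simp only [sum_addChar_mul hψ]
    rw [← Finset.sum_filter, Finset.sum_const, nsmul_eq_mul, mul_comm]
    rfl
  rw [h1, ← Finset.add_sum_erase _ _ (mem_univ (0 : F)),
    Finset.sum_congr rfl fun y hy => hg y (Finset.ne_of_mem_erase hy)]
  simp [Finset.card_erase_of_mem, Nat.cast_sub Fintype.card_pos]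

/-- Completing the square: translate a by (z / 2y)α. -/
theorem sum_addChar_sq_add_linear {F K : Type*} [Field F] [Field K] [Fintype K] [Algebra F K]
    {ψ : AddChar F ℂ} {g : ℂ} (h2 : (2 : F) ≠ 0)
    (hg : ∀ y : F, y ≠ 0 → ∑ x : K, ψ (y * Algebra.trace F K (x ^ 2)) = g)
    (α : K) {y : F} (hy : y ≠ 0) (z : F) :
    ∑ a : K, ψ (y * Algebra.trace F K (a ^ 2) + z * Algebra.trace F K (α * a)) =
      g * ψ (y⁻¹ * (-z ^ 2 * Algebra.trace F K (α ^ 2) / 4)) := by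
  have h4 : (4 : F) = 2 ^ 2 := by norm_num
  rw [← hg y hy, ← Equiv.sum_comp (Equiv.addRight ((z / (2 * y)) • α))
    (fun x : K => ψ (y * Algebra.trace F K (x ^ 2))), Finset.sum_mul]
  refine Finset.sum_congr rfl fun a _ => ?_
  rw [← AddChar.map_add_eq_mul]
  congr 1
  have e : (a + (z / (2 * y)) • α) ^ 2 =
      a ^ 2 + (z / y) • (α * a) + (z / (2 * y)) ^ 2 • α ^ 2 := by
    have : (z / y) = 2 * (z / (2 * y)) := by field_simp
    rw [this]
    simp only [Algebra.smul_def, map_mul, map_pow, map_ofNat]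
    ring
  rw [Equiv.coe_addRight, e, map_add, map_add, map_smul, map_smul, h4]
  simp only [smul_eq_mul]
  field_simp
  ring

theorem sum_sum_addChar_sq_add_linear [DecidableEq K] (h2 : (2 : F) ≠ 0) (hψ : ψ.IsPrimitive)
    (hg : ∀ y : F, y ≠ 0 → ∑ x : K, ψ (y * Algebra.trace F K (x ^ 2)) = g)
    {α : K} (hα : α ≠ 0) (z : F) :
    ∑ y : F, ∑ a : K, ψ (y * Algebra.trace F K (a ^ 2) + z * Algebra.trace F K (α * a)) =
      (if z = 0 then (Fintype.card K : ℂ) else 0) +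
        g * ((if Algebra.trace F K (α ^ 2) = 0 then (Fintype.card F : ℂ)
          else if z = 0 then (Fintype.card F : ℂ) else 0) - 1) := by
  have h4 : (4 : F) ≠ 0 := by
    rw [show (4 : F) = 2 ^ 2 by norm_num]; exact pow_ne_zero _ h2
  rw [← Finset.add_sum_erase _ _ (mem_univ (0 : F)),
    Finset.sum_congr rfl fun y hy =>
      sum_addChar_sq_add_linear h2 hg α (Finset.ne_of_mem_erase hy) z]
  congr 1
  · have h := sum_addChar_mul_trace (K := K) hψ (z • α)
    simp only [smul_mul_assoc, map_smul, smul_eq_mul] at h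
    simp [h, hα]
  · rw [← Finset.mul_sum, Finset.sum_erase_eq_sub (mem_univ _)]
    have h := sum_addChar_mul hψ (-z ^ 2 * Algebra.trace F K (α ^ 2) / 4)
    -- Inversion permutes F, with 0⁻¹ = 0, so y⁻¹ may replace y in the orthogonality relation; the
    -- removed term y = 0 is ψ(0) = 1.
    rw [← (inv_involutive (G := F)).bijective.sum_comp] at h
    rw [h]
    congr 2
    · by_cases hT : Algebra.trace F K (α ^ 2) = 0 <;> simp [hT, h4]
    · simp

/-- Two dual variables: y detects Tr(a²) = 0 and z detects Tr(αa) = t. The inner sums depend on z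
only through whether z = 0, so the sum over z against ψ(-zt) is immediate. -/
theorem card_sq_mul_isotropicCount (h2 : (2 : F) ≠ 0) (hψ : ψ.IsPrimitive)
    (hg : ∀ y : F, y ≠ 0 → ∑ x : K, ψ (y * Algebra.trace F K (x ^ 2)) = g)
    {α : K} (hα : α ≠ 0) (t : F) :
    (Fintype.card F : ℂ) ^ 2 * isotropicCount F α t =
      Fintype.card K + g * Fintype.card F *
        ((if Algebra.trace F K (α ^ 2) = 0 then (if t = 0 then (Fintype.card F : ℂ) else 0) else 1)
          - if t = 0 then 1 else 0) := by
  classical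
  have h1 : (Fintype.card F : ℂ) ^ 2 * isotropicCount F α t =
      ∑ z : F, ψ (z * -t) * ∑ y : F, ∑ a : K,
        ψ (y * Algebra.trace F K (a ^ 2) + z * Algebra.trace F K (α * a)) := by
    calc (Fintype.card F : ℂ) ^ 2 * isotropicCount F α t
        = ∑ a : K, (∑ z : F, ψ (z * (Algebra.trace F K (α * a) - t))) *
            ∑ y : F, ψ (y * Algebra.trace F K (a ^ 2)) := by
          simp only [sum_addChar_mul hψ, sub_eq_zero]
          have : ∀ a : K, ((if Algebra.trace F K (α * a) = t then (Fintype.card F : ℂ) else 0) *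
              if Algebra.trace F K (a ^ 2) = 0 then (Fintype.card F : ℂ) else 0) =
              if Algebra.trace F K (a ^ 2) = 0 ∧ Algebra.trace F K (α * a) = t
                then (Fintype.card F : ℂ) ^ 2 else 0 := by
            intro a
            split_ifs <;> simp_all [sq]
          rw [Finset.sum_congr rfl fun a _ => this a, ← Finset.sum_filter, Finset.sum_const,
            nsmul_eq_mul, mul_comm]
          rfl
      _ = _ := by
          simp only [Finset.sum_mul_sum]
          rw [Finset.sum_comm]
          refine Finset.sum_congr rfl fun z _ => ?_
          rw [Finset.sum_comm, Finset.mul_sum]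
          simp only [Finset.mul_sum]
          refine Finset.sum_congr rfl fun y _ => Finset.sum_congr rfl fun a _ => ?_
          rw [← AddChar.map_add_eq_mul, ← AddChar.map_add_eq_mul]
          congr 1
          ring
  rw [h1]
  simp only [sum_sum_addChar_sq_add_linear h2 hψ hg hα]
  have h3 : ∑ z : F, ψ (z * -t) = if t = 0 then (Fintype.card F : ℂ) else 0 := by
    simp only [sum_addChar_mul hψ, neg_eq_zero]
  by_cases hT : Algebra.trace F K (α ^ 2) = 0
  · simp only [hT, if_true, mul_add, Finset.sum_add_distrib, mul_ite, mul_zero,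
      Finset.sum_ite_eq', ← Finset.sum_mul, h3, Finset.mem_univ]
    split_ifs
    · simp
      ring
    · simp
  · simp only [hT, if_false, mul_add, mul_sub, Finset.sum_sub_distrib, Finset.sum_add_distrib,
      mul_ite, mul_zero, mul_one, Finset.sum_ite_eq', ← Finset.sum_mul, h3, Finset.mem_univ]
    split_ifs <;> simp [mul_comm g]

end Counts

/-! ### Freeness of the code, and compositions as convolutions. -/

section Codewords

open Finset

/-- If the code is parametrized injectively, it is free over `F + uF` of rank `[K : F]`. -/
theorem code_free_finrank {F K : Type*} [Field F] [Field K] [Algebra F K] [Module.Finite F K]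
    (hinj : Function.Injective (codeword F K)) :
    Module.Free (Ru F) (code F K) ∧ Module.finrank (Ru F) (code F K) = Module.finrank F K := by
  let b := Module.finBasis F K
  -- An F-basis of K is also a basis of K + uK over F + uF; X sends coordinates to elements.
  let X : (Fin (Module.finrank F K) → Ru F) → Ru K := fun r =>
    ⟨b.equivFun.symm fun i => (r i).re, b.equivFun.symm fun i => (r i).im⟩
  have hXadd : ∀ r s, X (r + s) = X r + X s := by
    intro r s
    ext
    · exact map_add b.equivFun.symm (fun i => (r i).re) (fun i => (s i).re)
    · exact map_add b.equivFun.symm (fun i => (r i).im) (fun i => (s i).im)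
  have hXsmul : ∀ (c : Ru F) r, X (c • r) = incl F K c * X r := by
    intro c r
    ext
    · simp [X, incl, Module.Basis.equivFun_symm_apply, Finset.sum_add_distrib, add_smul,
        ← Algebra.smul_def, Finset.smul_sum, smul_smul]
    · simp [X, incl, Module.Basis.equivFun_symm_apply, Finset.sum_add_distrib, add_smul,
        ← Algebra.smul_def, Finset.smul_sum, smul_smul]
  let f : (Fin (Module.finrank F K) → Ru F) →ₗ[Ru F] code F K :=
    { toFun := fun r => ⟨codeword F K (X r), X r, rfl⟩
      map_add' := fun r s => by
        ext1
        funext d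
        simp [codeword, hXadd, add_mul, tr_add]
      map_smul' := fun c r => by
        ext1
        funext d
        simp [codeword, hXsmul, mul_assoc, tr_incl_mul] }
  have hf : Function.Bijective f := by
    constructor
    · intro r s h
      have h1 : X r = X s := hinj (congrArg Subtype.val h)
      have h2 := b.equivFun.symm.injective (congrArg QuadraticAlgebra.re h1)
      have h3 := b.equivFun.symm.injective (congrArg QuadraticAlgebra.im h1)
      funext i
      exact QuadraticAlgebra.ext (congrFun h2 i) (congrFun h3 i)
    · rintro ⟨_, x, rfl⟩
      refine ⟨fun i => ⟨b.equivFun x.re i, b.equivFun x.im i⟩, Subtype.ext ?_⟩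
      change codeword F K (X _) = _
      congr 1
      ext
      · exact b.equivFun.symm_apply_apply x.re
      · exact b.equivFun.symm_apply_apply x.im
  let e := LinearEquiv.ofBijective f hf
  refine ⟨Module.Free.of_equiv e, ?_⟩
  rw [← e.finrank_eq, Module.finrank_fin_fun]

variable {F K : Type*} [Field F] [DecidableEq F] [Field K] [Fintype K] [Algebra F K]

/-- The pairs `(a, b)` with `Tr (a²) = Tr (b²) = 0` and `Tr (α a + β b) = s`. -/
noncomputable def isotropicPairs (α β : K) (s : F) : Finset (K × K) :=
  {p | (Algebra.trace F K (p.1 ^ 2) = 0 ∧ Algebra.trace F K (p.2 ^ 2) = 0) ∧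
    Algebra.trace F K (α * p.1) + Algebra.trace F K (β * p.2) = s}

theorem card_isotropicPairs [Fintype F] (α β : K) (s : F) :
    #(isotropicPairs α β s) = ∑ t : F, isotropicCount F α t * isotropicCount F β (s - t) := by
  rw [Finset.card_eq_sum_card_fiberwise (f := fun p : K × K => Algebra.trace F K (α * p.1))
    (t := univ) (fun _ _ => by simp)]
  refine Finset.sum_congr rfl fun t _ => ?_
  rw [isotropicCount, isotropicCount, ← Finset.card_product]
  congr 1
  ext p
  simp only [isotropicPairs, mem_filter, mem_univ, true_and, mem_product]
  constructor
  · rintro ⟨⟨⟨h1, h2⟩, h3⟩, h4⟩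
    exact ⟨⟨h1, h4⟩, h2, by rw [← h3, ← h4]; ring⟩
  · rintro ⟨⟨h1, h4⟩, h2, h3⟩
    exact ⟨⟨⟨h1, h2⟩, by rw [h3, h4]; ring⟩, h4⟩

/-- Functions of the form constant plus a multiple of the delta at 0 are closed under convolution,
so all nonzero symbols occur equally often. -/
theorem card_isotropicPairs_eq [Fintype F] {α β : K} {A B A' B' : ℚ}
    (hα : ∀ t : F, (isotropicCount F α t : ℚ) = A + if t = 0 then B else 0)
    (hβ : ∀ t : F, (isotropicCount F β t : ℚ) = A' + if t = 0 then B' else 0) (s : F) :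
    (#(isotropicPairs α β s) : ℚ) =
      Fintype.card F * A * A' + A * B' + A' * B + if s = 0 then B * B' else 0 := by
  rw [card_isotropicPairs]
  push_cast
  simp only [hα, hβ, mul_add, add_mul, Finset.sum_add_distrib, sub_eq_zero, ite_mul, zero_mul,
    mul_ite, mul_zero, Finset.sum_ite_eq', Finset.sum_ite_eq, Finset.mem_univ, if_true,
    Finset.sum_const, Finset.card_univ, nsmul_eq_mul]
  split_ifs <;> ring

theorem mem_definingSet_iff {F K : Type*} [Field F] [Field K] [Algebra F K] (d : Ru K) : d ∈ definingSet F K ↔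
    ¬(d.re = 0 ∧ d.im = 0) ∧ Algebra.trace F K (d.re ^ 2) = 0 ∧
      Algebra.trace F K (d.im ^ 2) = 0 := by
  rw [definingSet, Set.mem_ofPred_eq, Ne, QuadraticAlgebra.ext_iff, QuadraticAlgebra.ext_iff]
  rfl

variable [DecidableEq K]

theorem card_re_eq (x : Ru K) (s : F) :
    #{d : definingSet F K | (codeword F K x d).re = s} =
      #((isotropicPairs x.re x.im s).erase 0) := by
  refine Finset.card_bij (fun d _ => (d.1.re, d.1.im)) ?_ ?_ ?_
  · rintro ⟨d, hd⟩ h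
    rw [mem_definingSet_iff] at hd
    have h' := (Finset.mem_filter.mp h).2
    simp only [codeword, tr, QuadraticAlgebra.re_mul, one_mul, map_add] at h'
    simp only [isotropicPairs, mem_erase, mem_filter, mem_univ, true_and]
    exact ⟨fun h0 => hd.1 (Prod.mk.inj h0), hd.2, h'⟩
  · rintro d _ d' _ h
    rw [Prod.mk.injEq] at h
    exact Subtype.ext (QuadraticAlgebra.ext h.1 h.2)
  · rintro ⟨a, b⟩ h
    simp only [isotropicPairs, mem_erase, mem_filter, mem_univ, true_and] at h
    refine ⟨⟨⟨a, b⟩, (mem_definingSet_iff _).mpr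
      ⟨fun h0 => h.1 (Prod.ext h0.1 h0.2), h.2.1⟩⟩, ?_, rfl⟩
    simp only [mem_filter, mem_univ, true_and, codeword, tr, QuadraticAlgebra.re_mul, one_mul,
      map_add]
    exact h.2.2

/-- Because u² = 1, the imaginary part of xd is the real part with the coordinates of d exchanged;
hence the swap in the bijection. -/
theorem card_im_eq (x : Ru K) (s : F) :
    #{d : definingSet F K | (codeword F K x d).im = s} =
      #((isotropicPairs x.re x.im s).erase 0) := by
  refine Finset.card_bij (fun d _ => (d.1.im, d.1.re)) ?_ ?_ ?_
  · rintro ⟨d, hd⟩ h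
    rw [mem_definingSet_iff] at hd
    have h' := (Finset.mem_filter.mp h).2
    simp only [codeword, tr, QuadraticAlgebra.im_mul, zero_mul, add_zero, map_add] at h'
    simp only [isotropicPairs, mem_erase, mem_filter, mem_univ, true_and]
    exact ⟨fun h0 => hd.1 (Prod.mk.inj h0).symm, hd.2.symm, h'⟩
  · rintro d _ d' _ h
    rw [Prod.mk.injEq] at h
    exact Subtype.ext (QuadraticAlgebra.ext h.2 h.1)
  · rintro ⟨a, b⟩ h
    simp only [isotropicPairs, mem_erase, mem_filter, mem_univ, true_and] at h
    refine ⟨⟨⟨b, a⟩, (mem_definingSet_iff _).mpr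
      ⟨fun h0 => h.1 (Prod.ext h0.2 h0.1), h.2.1.symm⟩⟩, ?_, rfl⟩
    simp only [mem_filter, mem_univ, true_and, codeword, tr, QuadraticAlgebra.im_mul, zero_mul,
      add_zero, map_add]
    exact h.2.2

theorem card_definingSet_add_one :
    Fintype.card (definingSet F K) + 1 = isotropicCard F K ^ 2 := by
  -- For the zero message every coordinate is 0, so this count is the length; the pair (0, 0)
  -- accounts for the added 1.
  have h1 := card_re_eq (F := F) (0 : Ru K) 0
  have h2 : (0 : K × K) ∈ isotropicPairs (0 : K) 0 (0 : F) := by simp [isotropicPairs]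
  have h3 : #(isotropicPairs (0 : K) 0 (0 : F)) = isotropicCard F K ^ 2 := by
    rw [sq, isotropicCard, ← Finset.card_product]
    congr 1
    ext p
    simp [isotropicPairs]
  have h4 : #{d : definingSet F K | (codeword F K 0 d).re = 0} =
      Fintype.card (definingSet F K) := by
    rw [Finset.filter_true_of_mem, Finset.card_univ]
    intro d _
    simp [codeword, tr]
  rw [← h4, h1, ← h3]
  exact Finset.card_erase_add_one h2

/-- The correction 2 is the pair (0, 0), excluded from D, once for each half of the Gray image; it
only affects the symbol 0. -/
theorem comp_gray_codeword (x : Ru K) (s : F) :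
    comp (gray (codeword F K x)) s + (if s = 0 then 2 else 0) =
      2 * #(isotropicPairs x.re x.im s) := by
  have h1 : comp (gray (codeword F K x)) s = 2 * #((isotropicPairs x.re x.im s).erase 0) := by
    rw [two_mul]
    nth_rw 1 [← card_re_eq]
    rw [← card_im_eq]
    simp only [comp, Finset.card_filter, Fintype.sum_sum_type]
    rfl
  have h2 : (0 : K × K) ∈ isotropicPairs x.re x.im s ↔ s = 0 := by
    simp [isotropicPairs, eq_comm]
  rw [h1]
  split_ifs with hs
  · rw [← Finset.card_erase_add_one (h2.mpr hs)]
    ring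
  · rw [Finset.erase_eq_of_notMem (fun h => hs (h2.mp h)), add_zero]

end Codewords

/-! ### Lee weight from the composition; injectivity of the Gray map. -/

section Enumeration

open Finset

variable {F ι : Type*} [Field F] [DecidableEq F] [Fintype F] [Fintype ι]

theorem leeWeight_eq_sum_comp (c : ι → Ru F) :
    leeWeight c = ∑ s ∈ univ.erase (0 : F), comp (gray c) s := by
  rw [leeWeight, hammingNorm, Finset.card_eq_sum_card_fiberwise (f := gray c)
    (t := univ.erase (0 : F)) (fun i hi => by simpa using hi)]
  refine Finset.sum_congr rfl fun s hs => ?_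
  rw [comp, Finset.filter_filter]
  congr 1
  ext i
  simp only [mem_filter, mem_univ, true_and, and_iff_right_iff_imp]
  rintro h
  rw [h]
  exact Finset.ne_of_mem_erase hs

theorem gray_injective {F ι : Type*} [Field F] : Function.Injective (gray : (ι → Ru F) →ₗ[F] (ι ⊕ ι → F)) := by
  intro c c' h
  funext i
  exact QuadraticAlgebra.ext (congrFun h (Sum.inl i)) (congrFun h (Sum.inr i))

end Enumeration

/-! ### The six classes of messages and their sizes. -/

section Classes

open Finset

variable {F K : Type*} [Field F] [DecidableEq F] [Field K] [Fintype K] [DecidableEq K]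
  [Algebra F K]

/-- The type of `α`: `0` if `α = 0`, else `1` or `2` according as `Tr (α²)` vanishes or not. -/
noncomputable def isotropyType (F : Type*) {K : Type*} [Field F] [DecidableEq F] [Field K]
    [DecidableEq K] [Algebra F K] (α : K) : Fin 3 :=
  if α = 0 then 0 else if Algebra.trace F K (α ^ 2) = 0 then 1 else 2

/-- The number of elements of each type. -/
noncomputable def isotropyTypeCard (F K : Type*) [Field F] [DecidableEq F] [Field K]
    [DecidableEq K] [Fintype K] [Algebra F K] (i : Fin 3) : ℕ :=
  #{α : K | isotropyType F α = i}

/-- The index of an unordered pair of types. -/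
def pairIndex (i j : Fin 3) : Fin 6 := ![![0, 1, 2], ![1, 3, 4], ![2, 4, 5]] i j

/-- The unordered pair of types of the two coefficients of an element of `K + uK`. -/
noncomputable def pairType (F : Type*) {K : Type*} [Field F] [DecidableEq F] [Field K]
    [DecidableEq K] [Algebra F K] (x : Ru K) : Fin 6 :=
  pairIndex (isotropyType F x.re) (isotropyType F x.im)

theorem isotropyTypeCard_zero : isotropyTypeCard F K 0 = 1 := by
  rw [isotropyTypeCard, Finset.card_eq_one]
  refine ⟨0, ?_⟩
  ext α
  simp only [mem_filter, mem_univ, true_and, mem_singleton]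
  rw [isotropyType]
  split_ifs <;> simp_all

theorem isotropyTypeCard_one : isotropyTypeCard F K 1 + 1 = isotropicCard F K := by
  have h : (0 : K) ∈ ({a : K | Algebra.trace F K (a ^ 2) = 0} : Finset K) := by simp
  rw [isotropicCard, ← Finset.card_erase_add_one h, isotropyTypeCard]
  congr 2
  ext α
  simp only [mem_filter, mem_univ, true_and, mem_erase]
  rw [isotropyType]
  split_ifs <;> simp_all

theorem isotropyTypeCard_two : isotropyTypeCard F K 2 + isotropicCard F K = Fintype.card K := by
  rw [isotropicCard, ← Finset.card_univ, ← Finset.card_filter_add_card_filter_not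
    (s := (univ : Finset K)) (fun a => Algebra.trace F K (a ^ 2) = 0), add_comm,
    isotropyTypeCard]
  congr 2
  ext α
  simp only [mem_filter, mem_univ, true_and]
  rw [isotropyType]
  split_ifs <;> simp_all

theorem pairType_eq_zero_iff {F K : Type*} [Field F] [DecidableEq F] [Field K] [DecidableEq K]
    [Algebra F K] (x : Ru K) : pairType F x = 0 ↔ x = 0 := by
  have h : ∀ i j : Fin 3, pairIndex i j = 0 ↔ i = 0 ∧ j = 0 := by decide
  have h' : ∀ α : K, isotropyType F α = 0 ↔ α = 0 := by
    intro α
    rw [isotropyType]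
    split_ifs <;> simp_all
  rw [pairType, h, h', h', QuadraticAlgebra.ext_iff]
  rfl

theorem ncard_pairType (k : Fin 6) :
    {x : Ru K | pairType F x = k}.ncard =
      ∑ i, ∑ j, if pairIndex i j = k
        then isotropyTypeCard F K i * isotropyTypeCard F K j else 0 := by
  have h1 : {x : Ru K | pairType F x = k}.ncard =
      #{p : K × K | pairIndex (isotropyType F p.1) (isotropyType F p.2) = k} := by
    rw [← Set.ncard_coe_finset,
      ← Set.ncard_image_of_injective _ (QuadraticAlgebra.equivProd (1 : K) (0 : K)).injective]
    congr 1
    ext p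
    simp only [Set.mem_image, Set.mem_ofPred_eq, coe_filter, mem_univ, true_and]
    constructor
    · rintro ⟨x, hx, rfl⟩
      exact hx
    · intro h
      exact ⟨⟨p.1, p.2⟩, h, rfl⟩
  have h2 : ∀ f : Fin 3 → ℕ, ∑ a : K, f (isotropyType F a) =
      ∑ i, isotropyTypeCard F K i * f i := by
    intro f
    rw [← Finset.sum_fiberwise (s := univ) (g := fun a : K => isotropyType F a)]
    refine Finset.sum_congr rfl fun i _ => ?_
    rw [Finset.sum_congr rfl fun a ha => by rw [(Finset.mem_filter.mp ha).2], Finset.sum_const,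
      smul_eq_mul, isotropyTypeCard]
  rw [h1, Finset.card_filter, Fintype.sum_prod_type]
  have h3 : ∀ i, (∑ b : K, if pairIndex i (isotropyType F b) = k then 1 else 0) =
      ∑ j, isotropyTypeCard F K j * if pairIndex i j = k then 1 else 0 :=
    fun i => h2 fun j => if pairIndex i j = k then 1 else 0
  simp only [h3]
  refine (h2 fun i => ∑ j, isotropyTypeCard F K j * if pairIndex i j = k then 1 else 0).trans ?_
  simp only [Finset.mul_sum, mul_ite, mul_one, mul_zero]

theorem ncard_pairType_eq (k : Fin 6) :
    {x : Ru K | pairType F x = k}.ncard =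
      ![1, 2 * isotropyTypeCard F K 1, 2 * isotropyTypeCard F K 2, isotropyTypeCard F K 1 ^ 2,
        2 * isotropyTypeCard F K 1 * isotropyTypeCard F K 2, isotropyTypeCard F K 2 ^ 2] k := by
  rw [ncard_pairType]
  fin_cases k <;>
    simp [Fin.sum_univ_three, pairIndex, isotropyTypeCard_zero] <;> ring

end Classes

/-! ### From statistics of messages to statistics of codewords. -/

section Distribution

open Finset

variable {F K : Type*} [Field F] [DecidableEq F] [Field K] [Finite K] [Algebra F K]

/-- Counting the codewords of given weight when the weight factors through an injective function
of a statistic of the message. -/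
theorem leeCount_code (hinj : Function.Injective (codeword F K)) {κ : Type*} {T : Ru K → κ}
    {W : κ → ℕ} (hW : Function.Injective W) (h : ∀ x, leeWeight (codeword F K x) = W (T x))
    (k : κ) : leeCount (code F K) (W k) = {x | T x = k}.ncard := by
  rw [leeCount, ← Set.ncard_image_of_injective _ hinj]
  congr 1
  ext c
  simp only [Set.mem_image, Set.mem_ofPred_eq]
  constructor
  · rintro ⟨⟨x, rfl⟩, hx⟩
    exact ⟨x, hW (by rw [← h, hx]), rfl⟩
  · rintro ⟨x, rfl, rfl⟩
    exact ⟨⟨x, rfl⟩, h x⟩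

theorem leeCount_code_eq_zero {κ : Type*} {T : Ru K → κ} {W : κ → ℕ}
    (h : ∀ x, leeWeight (codeword F K x) = W (T x)) {v : ℕ} (hv : ∀ k, v ≠ W k) :
    leeCount (code F K) v = 0 := by
  rw [leeCount]
  convert Set.ncard_empty (definingSet F K → Ru F)
  ext c
  simp only [Set.mem_ofPred_eq, Set.mem_empty_iff_false, iff_false]
  rintro ⟨⟨x, rfl⟩, hx⟩
  exact hv (T x) (by rw [← h, hx])

theorem codeword_sub {F K : Type*} [Field F] [Field K] [Algebra F K] (x y : Ru K) : codeword F K (x - y) = codeword F K x - codeword F K y := by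
  funext d
  rw [Pi.sub_apply, eq_sub_iff_add_eq, codeword, codeword, codeword, ← tr_add, ← add_mul,
    sub_add_cancel]

theorem codeword_injective (h : ∀ x : Ru K, leeWeight (codeword F K x) = 0 → x = 0) :
    Function.Injective (codeword F K) := by
  intro x y hxy
  rw [← sub_eq_zero]
  apply h
  rw [codeword_sub, hxy, sub_self, leeWeight, map_zero, hammingNorm_zero]

/-- The complete weight enumerator when the composition of a codeword depends only on a statistic
of the message, and all nonzero symbols occur equally often. -/
theorem completeWeightEnumerator_code [Fintype F] (hinj : Function.Injective (codeword F K)) {κ : Type*}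
    [Fintype κ] {T : Ru K → κ} {e₀ e : κ → ℕ}
    (h₀ : ∀ x, comp (gray (codeword F K x)) 0 = e₀ (T x))
    (h : ∀ x, ∀ s ≠ 0, comp (gray (codeword F K x)) s = e (T x)) :
    completeWeightEnumerator (grayImage (code F K)) =
      ∑ k, MvPolynomial.C ({x | T x = k}.ncard : ℚ) * MvPolynomial.X (0 : F) ^ e₀ k *
        ∏ s ∈ univ.erase (0 : F), MvPolynomial.X s ^ e k := by
  classical
  have := Fintype.ofFinite (Ru K)
  rw [completeWeightEnumerator]
  trans ∑ x : Ru K, ∏ s : F, MvPolynomial.X s ^ comp (gray (codeword F K x)) s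
  · symm
    refine Finset.sum_bij (fun x _ => gray (codeword F K x)) ?_ ?_ ?_ ?_
    · intro x _
      simp only [mem_filter, mem_univ, true_and]
      exact ⟨_, ⟨x, rfl⟩, rfl⟩
    · intro x _ y _ hxy
      exact hinj (gray_injective hxy)
    · intro c hc
      obtain ⟨_, ⟨x, rfl⟩, rfl⟩ := (Finset.mem_filter.mp hc).2
      exact ⟨x, mem_univ _, rfl⟩
    · intro x _
      refine Finset.prod_congr rfl fun s _ => ?_
      congr!
  have h2 : ∀ x : Ru K, ∏ s : F, (MvPolynomial.X s : MvPolynomial F ℚ) ^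
      comp (gray (codeword F K x)) s =
      MvPolynomial.X (0 : F) ^ e₀ (T x) *
        ∏ s ∈ univ.erase (0 : F), MvPolynomial.X s ^ e (T x) := by
    intro x
    rw [← Finset.mul_prod_erase _ _ (mem_univ (0 : F)), h₀]
    congr 1
    exact Finset.prod_congr rfl fun s hs => by rw [h x s (Finset.ne_of_mem_erase hs)]
  rw [Finset.sum_congr rfl fun x _ => h2 x, ← Finset.sum_fiberwise (s := univ) (g := T)]
  refine Finset.sum_congr rfl fun k _ => ?_
  rw [Finset.sum_congr rfl fun x hx => by rw [(Finset.mem_filter.mp hx).2], Finset.sum_const,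
    nsmul_eq_mul, ← mul_assoc]
  congr 2
  rw [Set.ncard_eq_toFinset_card', map_natCast]
  congr 3
  ext x
  simp

end Distribution

/-! ### Closed forms in q, r = q^(m/2 - 1) and ε, with G = εqr. -/

section Parameters

open Finset

/-- The number of `a` with `Tr (a²) = 0` and `Tr (α a) = t` for `t ≠ 0`, by the type of `α`. -/
def baseCount (r ε : ℚ) : Fin 3 → ℚ := ![0, r ^ 2, r ^ 2 + ε * r]

/-- The excess of the number of `a` with `Tr (a²) = 0` and `Tr (α a) = 0`, by the type of `α`. -/
def excessCount (q r ε : ℚ) : Fin 3 → ℚ :=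
  ![q * r ^ 2 + (q - 1) * ε * r, (q - 1) * ε * r, -(ε * r)]

/-- The number of occurrences of a nonzero symbol, divided by `2r²`. -/
def symbolRate (q r ε : ℚ) : Fin 6 → ℚ :=
  ![0, q * r ^ 2 + (q - 1) * ε * r, q * r ^ 2 + (2 * q - 1) * ε * r + (q - 1),
    q * r ^ 2 + 2 * (q - 1) * ε * r, q * r ^ 2 + 2 * (q - 1) * ε * r + (q - 1),
    q * r ^ 2 + 2 * (q - 1) * ε * r + (q - 2)]

/-- Half the excess of the number of zeros over that of any other symbol. -/
def zeroExcess (q r ε : ℚ) : Fin 6 → ℚ :=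
  ![(q * r ^ 2 + (q - 1) * ε * r) ^ 2, (q * r ^ 2 + (q - 1) * ε * r) * ((q - 1) * ε * r),
    -((q * r ^ 2 + (q - 1) * ε * r) * (ε * r)), (q - 1) ^ 2 * r ^ 2, -((q - 1) * r ^ 2), r ^ 2]

/-- Indexing by class, the increasing order is 0, 1, 3, 5, 4, 2 for ε = 1 and 0, 2, 3, 5, 4, 1 for ε
= -1. In the second case class 3 exceeds class 2 by r - (q - 1), hence the need for q ≤ r. -/
theorem symbolRate_injective {q r ε : ℚ} (hq : 3 ≤ q) (hr : 1 ≤ r)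
    (h : ε = 1 ∨ ε = -1 ∧ q ≤ r) : Function.Injective (symbolRate q r ε) := by
  have key : ∀ a b c d e : ℚ, (0 < a ∧ a < c ∧ c < e ∧ e < d ∧ d < b) ∨
      (0 < b ∧ b < c ∧ c < e ∧ e < d ∧ d < a) →
      Function.Injective (![0, a, b, c, d, e] : Fin 6 → ℚ) := by
    intro a b c d e h i j hij
    fin_cases i <;> fin_cases j <;> first | rfl | (exfalso; simp at hij; rcases h with h | h <;> linarith)
  apply key
  rcases h with rfl | ⟨rfl, h⟩
  · left
    refine ⟨by nlinarith, by nlinarith, by linarith, by linarith, by nlinarith⟩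
  · right
    refine ⟨?_, by nlinarith, by linarith, by linarith, by nlinarith⟩
    -- This product is the class 2 value at ε = -1; it vanishes at r = 1.
    have : 0 < (q * r - (q - 1)) * (r - 1) := mul_pos (by nlinarith) (by linarith)
    linarith

/-- These are the two coefficients in `card_isotropicPairs_eq`; they are symmetric in the types, so
the unordered pair suffices. -/
theorem pair_counts {q r ε : ℚ} (hε : ε ^ 2 = 1) (i j : Fin 3) :
    q * baseCount r ε i * baseCount r ε j + baseCount r ε i * excessCount q r ε j +
      baseCount r ε j * excessCount q r ε i = r ^ 2 * symbolRate q r ε (pairIndex i j) ∧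
    excessCount q r ε i * excessCount q r ε j = zeroExcess q r ε (pairIndex i j) := by
  fin_cases i <;> fin_cases j <;>
    simp [baseCount, excessCount, pairIndex, symbolRate, zeroExcess] <;> grind

/-- For m = 2l + 2 and r = q^l, the expressions `q * r ^ 4`, `r ^ 2 / q` and `r ^ 2` are q^(2m-3),
q^(m-3) and q^(m-2); the quotient form also covers m = 2, where m - 3 = -1. -/
theorem zero_exponents {q r ε G P₂ P₃ Q₃ : ℚ} (hq : q ≠ 0) (hε : ε ^ 2 = 1) (hG : G = ε * q * r)
    (hP₂ : P₂ = 2 * (q * r ^ 4) + 4 * G * (q - 1) * (r ^ 2 / q))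
    (hP₃ : P₃ = q * r ^ 2 + (q - 1) * ε * r) (hQ₃ : Q₃ = 2 * (q - 1) * r ^ 2) (k : Fin 6) :
    2 * r ^ 2 * symbolRate q r ε k + (2 * zeroExcess q r ε k - 2) =
      ![2 * P₃ ^ 2 - 2,
        P₂ + Q₃ * (q - 1) * (q + G) * q⁻¹ - 2,
        P₂ - Q₃ * q⁻¹ * G - 2,
        P₂ + (q - 1) * Q₃ - 2,
        P₂ - 2,
        P₂ + Q₃ - 2] k := by
  have hP₂' : P₂ = 2 * q * r ^ 4 + 4 * ε * (q - 1) * r ^ 3 := by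
    rw [hP₂, hG]
    field_simp
  have h1 : Q₃ * (q - 1) * (q + G) * q⁻¹ = 2 * (q - 1) ^ 2 * r ^ 2 * (1 + ε * r) := by
    rw [hQ₃, hG]
    field_simp
  have h2 : Q₃ * q⁻¹ * G = 2 * (q - 1) * ε * r ^ 3 := by
    rw [hQ₃, hG]
    field_simp
  rw [h1, h2, hP₂', hP₃, hQ₃]
  clear hP₂ hP₂' hP₃ hQ₃ hG h1 h2 hq
  fin_cases k <;> simp [symbolRate, zeroExcess]
  · linear_combination 2 * (q - 1) ^ 2 * r ^ 2 * hε
  · linear_combination -(2 * (q - 1) * r ^ 2) * hε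
  · ring
  · ring
  · ring

theorem symbol_exponents {q r ε G P₂ Q₃ : ℚ} (hq : q ≠ 0) (hG : G = ε * q * r)
    (hP₂ : P₂ = 2 * (q * r ^ 4) + 4 * G * (q - 1) * (r ^ 2 / q))
    (hQ₃ : Q₃ = 2 * (q - 1) * r ^ 2) (k : Fin 6) :
    2 * r ^ 2 * symbolRate q r ε k =
      ![0,
        P₂ - Q₃ * q⁻¹ * G,
        P₂ + Q₃ + 2 * G * (r ^ 2 / q),
        P₂,
        P₂ + Q₃,
        P₂ + 2 * (q - 2) * r ^ 2] k := by
  have hP₂' : P₂ = 2 * q * r ^ 4 + 4 * ε * (q - 1) * r ^ 3 := by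
    rw [hP₂, hG]
    field_simp
  have h1 : 2 * G * (r ^ 2 / q) = 2 * ε * r ^ 3 := by
    rw [hG]
    field_simp
  have h2 : Q₃ * q⁻¹ * G = 2 * (q - 1) * ε * r ^ 3 := by
    rw [hQ₃, hG]
    field_simp
  rw [h1, h2, hP₂', hQ₃]
  fin_cases k <;> simp [symbolRate] <;> ring

theorem lee_weights {q r ε G : ℚ} (hq : q ≠ 0) (hG : G = ε * q * r) (i : Fin 5) :
    (q - 1) * (2 * r ^ 2 * symbolRate q r ε i.succ) =
      ![2 * (q - 1) * (q * r ^ 4) + 2 * G * (q - 1) ^ 2 * (r ^ 2 / q),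
        2 * (q - 1) * (q * r ^ 4) + 2 * G * (q - 1) * (2 * q - 1) * (r ^ 2 / q)
          + 2 * (q - 1) ^ 2 * r ^ 2,
        2 * (q - 1) * (q * r ^ 4) + 4 * G * (q - 1) ^ 2 * (r ^ 2 / q),
        2 * (q - 1) * (q * r ^ 4) + 4 * G * (q - 1) ^ 2 * (r ^ 2 / q) + 2 * (q - 1) ^ 2 * r ^ 2,
        2 * (q - 1) * (q * r ^ 4) + 4 * G * (q - 1) ^ 2 * (r ^ 2 / q)
          + 2 * (q - 1) * (q - 2) * r ^ 2] i := by
  have h : r ^ 2 / q = r ^ 2 * q⁻¹ := div_eq_mul_inv _ _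
  have h' : q * q⁻¹ = 1 := mul_inv_cancel₀ hq
  rw [hG, h]
  fin_cases i <;> simp [symbolRate]
  · linear_combination -(2 * ε * r ^ 3 * (q - 1) ^ 2) * h'
  · linear_combination -(2 * ε * r ^ 3 * (q - 1) * (2 * q - 1)) * h'
  · linear_combination -(4 * ε * r ^ 3 * (q - 1) ^ 2) * h'
  · linear_combination -(4 * ε * r ^ 3 * (q - 1) ^ 2) * h'
  · linear_combination -(4 * ε * r ^ 3 * (q - 1) ^ 2) * h'

variable {F K : Type*} [Field F] [DecidableEq F] [Fintype F] [Field K] [Fintype K]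
  [Algebra F K] {r ε : ℚ}

theorem isotropicCard_eq {ψ : AddChar F ℂ} (hψ : ψ.IsPrimitive)
    (hK : (Fintype.card K : ℚ) = Fintype.card F ^ 2 * r ^ 2)
    (hg : ∀ y : F, y ≠ 0 → ∑ x : K, ψ (y * Algebra.trace F K (x ^ 2)) =
      ((ε * Fintype.card F * r : ℚ) : ℂ)) :
    (isotropicCard F K : ℚ) = Fintype.card F * r ^ 2 + (Fintype.card F - 1) * ε * r := by
  have h0 : (Fintype.card F : ℚ) ≠ 0 := by exact_mod_cast Fintype.card_ne_zero
  have h1 := card_mul_isotropicCard hψ hg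
  have h2 : (Fintype.card F : ℚ) * isotropicCard F K =
      Fintype.card K + (Fintype.card F - 1) * (ε * Fintype.card F * r) := by
    exact_mod_cast h1
  apply mul_left_cancel₀ h0
  rw [h2, hK]
  ring

variable [DecidableEq K]

theorem isotropicCount_eq (hF : (2 : F) ≠ 0) {ψ : AddChar F ℂ} (hψ : ψ.IsPrimitive)
    (hK : (Fintype.card K : ℚ) = Fintype.card F ^ 2 * r ^ 2)
    (hg : ∀ y : F, y ≠ 0 → ∑ x : K, ψ (y * Algebra.trace F K (x ^ 2)) =
      ((ε * Fintype.card F * r : ℚ) : ℂ)) (α : K) (t : F) :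
    (isotropicCount F α t : ℚ) = baseCount r ε (isotropyType F α) +
      if t = 0 then excessCount (Fintype.card F) r ε (isotropyType F α) else 0 := by
  have h0 : (Fintype.card F : ℚ) ≠ 0 := by exact_mod_cast Fintype.card_ne_zero
  by_cases hα : α = 0
  · subst hα
    rw [isotropicCount_zero, isotropyType, if_pos rfl]
    split_ifs
    · simp [baseCount, excessCount, isotropicCard_eq hψ hK hg]
    · simp [baseCount]
  · have h1 := card_sq_mul_isotropicCount hF hψ hg hα t
    have h2 : (Fintype.card F : ℚ) ^ 2 * isotropicCount F α t =
        Fintype.card K + ε * Fintype.card F * r * Fintype.card F *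
        ((if Algebra.trace F K (α ^ 2) = 0 then (if t = 0 then (Fintype.card F : ℚ) else 0) else 1)
          - if t = 0 then 1 else 0) := by
      apply Rat.cast_injective (α := ℂ)
      push_cast at h1 ⊢
      rw [h1]
      split_ifs <;> push_cast <;> rfl
    apply mul_left_cancel₀ (pow_ne_zero 2 h0)
    rw [h2, hK, isotropyType, if_neg hα]
    split_ifs <;> simp [baseCount, excessCount] <;> ring

theorem comp_gray_codeword_eq (hε : ε ^ 2 = 1)
    (hc : ∀ (α : K) (t : F), (isotropicCount F α t : ℚ) =
      baseCount r ε (isotropyType F α) +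
        if t = 0 then excessCount (Fintype.card F) r ε (isotropyType F α) else 0)
    (x : Ru K) (s : F) :
    (comp (gray (codeword F K x)) s : ℚ) =
      2 * r ^ 2 * symbolRate (Fintype.card F) r ε (pairType F x) +
        if s = 0 then 2 * zeroExcess (Fintype.card F) r ε (pairType F x) - 2 else 0 := by
  have h1 := comp_gray_codeword x s
  have h2 := card_isotropicPairs_eq (hc x.re) (hc x.im) s
  obtain ⟨h3, h4⟩ := pair_counts (q := Fintype.card F) (r := r) hε
    (isotropyType F x.re) (isotropyType F x.im)
  rw [h3, h4] at h2
  have h5 : (comp (gray (codeword F K x)) s : ℚ) + (if s = 0 then 2 else 0) =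
      2 * (#(isotropicPairs x.re x.im s) : ℚ) := by exact_mod_cast h1
  rw [h2] at h5
  rw [pairType]
  split_ifs at h5 ⊢ <;> linarith

theorem leeWeight_codeword_eq
    (hcomp : ∀ (x : Ru K) (s : F), (comp (gray (codeword F K x)) s : ℚ) =
      2 * r ^ 2 * symbolRate (Fintype.card F) r ε (pairType F x) +
        if s = 0 then 2 * zeroExcess (Fintype.card F) r ε (pairType F x) - 2 else 0)
    (x : Ru K) : (leeWeight (codeword F K x) : ℚ) = (Fintype.card F - 1) *
      (2 * r ^ 2 * symbolRate (Fintype.card F) r ε (pairType F x)) := by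
  rw [leeWeight_eq_sum_comp, Nat.cast_sum,
    Finset.sum_congr rfl fun s hs => by rw [hcomp, if_neg (Finset.ne_of_mem_erase hs), add_zero],
    Finset.sum_const, Finset.card_erase_of_mem (mem_univ _), Finset.card_univ, nsmul_eq_mul,
    Nat.cast_sub Fintype.card_pos, Nat.cast_one]

end Parameters

open Finset

theorem leeCount_code_zero {F K : Type*} [Field F] [DecidableEq F] [Field K] [Finite K]
    [Algebra F K] (h : ∀ x : Ru K, leeWeight (codeword F K x) = 0 → x = 0) :
    leeCount (code F K) 0 = 1 := by
  rw [leeCount, Set.ncard_eq_one]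
  refine ⟨0, ?_⟩
  ext c
  simp only [Set.mem_ofPred_eq, Set.mem_singleton_iff]
  constructor
  · rintro ⟨⟨x, rfl⟩, hx⟩
    rw [h x hx]
    funext d
    simp [codeword, tr]
    rfl
  · rintro rfl
    exact ⟨zero_mem _, by rw [leeWeight, map_zero, hammingNorm_zero]⟩

end LeeCode

/-! ### Assembly of the length, weight distribution and enumerator. -/

open Finset LeeCode in
theorem mainTheorem2 (q m : ℕ) [Fact q.Prime] (hq : Odd q) (hm : 2 ≤ m) (hme : Even m)
    (K : Type*) [Field K] [Finite K] [Algebra (ZMod q) K] (hK : Nat.card K = q ^ m)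
    (G P₂ Q₂ P₃ Q₃ : ℚ)
    (hG : G = -(-1) ^ ((q - 1) ^ 2 * m / 8) * (q : ℚ) ^ (m / 2))
    (hP₂ : P₂ = 2 * (q : ℚ) ^ (2 * m - 3) + 4 * G * (q - 1) * (q : ℚ) ^ ((m : ℤ) - 3))
    (hQ₂ : Q₂ = (q - 1) * ((q : ℚ) ^ (m - 1) - (q : ℚ)⁻¹ * G))
    (hP₃ : P₃ = (q : ℚ) ^ (m - 1) + (q : ℚ)⁻¹ * (q - 1) * G)
    (hQ₃ : Q₃ = 2 * (q - 1) * (q : ℚ) ^ (m - 2)) :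
    -- the length
    (Fintype.card (LeeCode.definingSet (ZMod q) K) : ℚ)
        = ((q : ℚ) ^ (m - 1) + (q : ℚ)⁻¹ * (q - 1) * G) ^ 2 - 1 ∧
    ((LeeCode.definingSet (ZMod q) K).Nonempty →
      -- the code is free of rank `m` over `F_q + u F_q`
      (Module.Free (LeeCode.Ru (ZMod q)) (LeeCode.code (ZMod q) K) ∧
        Module.finrank (LeeCode.Ru (ZMod q)) (LeeCode.code (ZMod q) K) = m) ∧
      -- the Lee-weight distribution: exactly five nonzero weights
      (∃ w : Fin 5 → ℕ,
        Function.Injective w ∧ (∀ i, w i ≠ 0) ∧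
        (∀ i, (w i : ℚ) =
          ![2 * (q - 1) * (q : ℚ) ^ (2 * m - 3) + 2 * G * (q - 1) ^ 2 * (q : ℚ) ^ ((m : ℤ) - 3),
            2 * (q - 1) * (q : ℚ) ^ (2 * m - 3)
              + 2 * G * (q - 1) * (2 * q - 1) * (q : ℚ) ^ ((m : ℤ) - 3)
              + 2 * (q - 1) ^ 2 * (q : ℚ) ^ (m - 2),
            2 * (q - 1) * (q : ℚ) ^ (2 * m - 3) + 4 * G * (q - 1) ^ 2 * (q : ℚ) ^ ((m : ℤ) - 3),
            2 * (q - 1) * (q : ℚ) ^ (2 * m - 3) + 4 * G * (q - 1) ^ 2 * (q : ℚ) ^ ((m : ℤ) - 3)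
              + 2 * (q - 1) ^ 2 * (q : ℚ) ^ (m - 2),
            2 * (q - 1) * (q : ℚ) ^ (2 * m - 3) + 4 * G * (q - 1) ^ 2 * (q : ℚ) ^ ((m : ℤ) - 3)
              + 2 * (q - 1) * (q - 2) * (q : ℚ) ^ (m - 2)] i) ∧
        LeeCode.leeCount (LeeCode.code (ZMod q) K) 0 = 1 ∧
        (∀ i, LeeCode.leeCount (LeeCode.code (ZMod q) K) (w i) ≠ 0) ∧
        (∀ i, (LeeCode.leeCount (LeeCode.code (ZMod q) K) (w i) : ℚ) =
          ![2 * ((q : ℚ) ^ (m - 1) + (q : ℚ)⁻¹ * (q - 1) * G - 1),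
            2 * (q - 1) * ((q : ℚ) ^ (m - 1) - (q : ℚ)⁻¹ * G),
            ((q : ℚ) ^ (m - 1) + (q : ℚ)⁻¹ * (q - 1) * G - 1) ^ 2,
            2 * (q - 1) * ((q : ℚ) ^ (m - 1) - (q : ℚ)⁻¹ * G)
              * ((q : ℚ) ^ (m - 1) + (q : ℚ)⁻¹ * (q - 1) * G - 1),
            (q - 1) ^ 2 * ((q : ℚ) ^ (m - 1) - (q : ℚ)⁻¹ * G) ^ 2] i) ∧
        (∀ v : ℕ, v ≠ 0 → (∀ i, v ≠ w i) →
          LeeCode.leeCount (LeeCode.code (ZMod q) K) v = 0)) ∧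
      -- the complete weight enumerator of the Gray image; `e₀ i` is the exponent of `w_0` and
      -- `e i` the common exponent of the other variables in the `i`-th term
      (∃ e₀ e : Fin 6 → ℕ,
        (∀ i, (e₀ i : ℚ) =
          ![2 * P₃ ^ 2 - 2,
            P₂ + Q₃ * (q - 1) * (q + G) * (q : ℚ)⁻¹ - 2,
            P₂ - Q₃ * (q : ℚ)⁻¹ * G - 2,
            P₂ + (q - 1) * Q₃ - 2,
            P₂ - 2,
            P₂ + Q₃ - 2] i) ∧
        (∀ i, (e i : ℚ) =
          ![0,
            P₂ - Q₃ * (q : ℚ)⁻¹ * G,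
            P₂ + Q₃ + 2 * G * (q : ℚ) ^ ((m : ℤ) - 3),
            P₂,
            P₂ + Q₃,
            P₂ + 2 * (q - 2) * (q : ℚ) ^ (m - 2)] i) ∧
        LeeCode.completeWeightEnumerator (LeeCode.grayImage (LeeCode.code (ZMod q) K)) =
          ∑ i : Fin 6,
            MvPolynomial.C
                (![1, 2 * (P₃ - 1), 2 * Q₂, (P₃ - 1) ^ 2, 2 * Q₂ * (P₃ - 1), Q₂ ^ 2] i)
              * MvPolynomial.X (0 : ZMod q) ^ e₀ i
              * ∏ s ∈ Finset.univ.erase (0 : ZMod q), MvPolynomial.X s ^ e i)) := by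
  classical
  have := Fintype.ofFinite K
  have hqp : q.Prime := Fact.out
  have hq3 : 3 ≤ q := by
    rcases hqp.two_le.lt_or_eq with h | h
    · exact h
    · exact absurd hq (by rw [← h]; decide)
  have hcF : Fintype.card (ZMod q) = q := ZMod.card q
  obtain ⟨ψ, hψ⟩ : ∃ ψ : AddChar (ZMod q) ℂ, ψ.IsPrimitive :=
    ⟨ZMod.stdAddChar, ZMod.isPrimitive_stdAddChar q⟩
  have hgauss := fun (y : ZMod q) (hy : y ≠ 0) =>
    sum_traceChar_mul_sq hq (by omega : m ≠ 0) hme K hK hψ hy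
  have hfr : Module.finrank (ZMod q) K = m := by
    have h1 := FiniteField.pow_finrank_eq_natCard q K
    rw [hK] at h1
    exact Nat.pow_right_injective hqp.two_le h1
  obtain ⟨l, rfl⟩ : ∃ l, m = 2 * l + 2 := by
    obtain ⟨k, rfl⟩ := hme
    exact ⟨k - 1, by omega⟩
  set ε : ℚ := -(-1) ^ ((q - 1) ^ 2 * (2 * l + 2) / 8) with hεdef
  set r : ℚ := (q : ℚ) ^ l with hr
  have hε1 : ε = 1 ∨ ε = -1 := by
    rcases neg_one_pow_eq_or ℚ ((q - 1) ^ 2 * (2 * l + 2) / 8) with h | h <;> simp [hεdef, h]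
  have hε2 : ε ^ 2 = 1 := by rcases hε1 with h | h <;> simp [h]
  have hQ3 : (3 : ℚ) ≤ q := by exact_mod_cast hq3
  have hQ0 : (q : ℚ) ≠ 0 := by linarith
  have hr1 : 1 ≤ r := one_le_pow₀ (by linarith)
  have hG' : G = ε * q * r := by
    rw [hG, show (2 * l + 2) / 2 = l + 1 by omega, pow_succ]
    ring
  have p1 : (q : ℚ) ^ (2 * l + 2 - 1) = q * r ^ 2 := by
    rw [show 2 * l + 2 - 1 = l * 2 + 1 by omega, pow_succ, pow_mul, mul_comm]
  have p2 : (q : ℚ) ^ (2 * l + 2 - 2) = r ^ 2 := by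
    rw [show 2 * l + 2 - 2 = l * 2 by omega, pow_mul]
  have p3 : (q : ℚ) ^ (2 * (2 * l + 2) - 3) = q * r ^ 4 := by
    rw [show 2 * (2 * l + 2) - 3 = l * 4 + 1 by omega, pow_succ, pow_mul, mul_comm]
  have p4 : (q : ℚ) ^ (((2 * l + 2 : ℕ) : ℤ) - 3) = r ^ 2 / q := by
    rw [show (((2 * l + 2 : ℕ) : ℤ) - 3) = ((l * 2 : ℕ) : ℤ) - 1 by push_cast; ring,
      zpow_sub₀ hQ0, zpow_natCast, zpow_one, pow_mul]
  have hcK : (Fintype.card K : ℚ) = Fintype.card (ZMod q) ^ 2 * r ^ 2 := by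
    rw [← Nat.card_eq_fintype_card, hK, hcF, hr]
    push_cast
    ring
  have hg : ∀ y : ZMod q, y ≠ 0 → ∑ x : K, ψ (y * Algebra.trace (ZMod q) K (x ^ 2)) =
      ((ε * Fintype.card (ZMod q) * r : ℚ) : ℂ) := by
    intro y hy
    rw [hgauss y hy, hcF, show (2 * l + 2) / 2 = l + 1 by omega, hεdef, hr]
    push_cast
    ring
  have h20 : (2 : ZMod q) ≠ 0 := Ring.two_ne_zero (ringChar_ne_two_of_odd hq)
  have hN := isotropicCard_eq hψ hcK hg
  have hcomp := comp_gray_codeword_eq hε2 (isotropicCount_eq h20 hψ hcK hg)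
  have hlee := leeWeight_codeword_eq hcomp
  rw [hcF] at hN
  simp only [hcF] at hcomp hlee
  have hD := card_definingSet_add_one (F := ZMod q) (K := K)
  have hDQ : (Fintype.card (definingSet (ZMod q) K) : ℚ) =
      (q * r ^ 2 + (q - 1) * ε * r) ^ 2 - 1 := by
    rw [← hN, eq_sub_iff_add_eq]
    exact_mod_cast hD
  simp only [p1, p2, p3, p4] at *
  have hP₃' : P₃ = q * r ^ 2 + (q - 1) * ε * r := by
    rw [hP₃, hG']
    field_simp
  have hQ₂' : Q₂ = (q - 1) * (q * r ^ 2 - ε * r) := by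
    rw [hQ₂, hG']
    field_simp
  have n1 : (isotropyTypeCard (ZMod q) K 1 : ℚ) = P₃ - 1 := by
    rw [hP₃', ← hN, eq_sub_iff_add_eq]
    exact_mod_cast isotropyTypeCard_one
  have n2 : (isotropyTypeCard (ZMod q) K 2 : ℚ) = Q₂ := by
    have h : (isotropyTypeCard (ZMod q) K 2 : ℚ) + isotropicCard (ZMod q) K = Fintype.card K := by
      exact_mod_cast isotropyTypeCard_two
    rw [hN, hcK, hcF] at h
    rw [hQ₂']
    linear_combination h
  refine ⟨by rw [hDQ, hG']; field_simp, fun hne => ?_⟩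
  have hN1 : 1 < P₃ := by
    have : Nonempty (definingSet (ZMod q) K) := hne.to_subtype
    have h1 : 1 < isotropicCard (ZMod q) K := by
      have h2 : 0 < Fintype.card (definingSet (ZMod q) K) := Fintype.card_pos
      by_contra h
      have : isotropicCard (ZMod q) K ^ 2 ≤ 1 := pow_le_one₀ (Nat.zero_le _) (not_lt.mp h)
      omega
    rw [hP₃', ← hN]
    exact_mod_cast h1
  -- Nonemptiness of D enters here: ε = -1 with l = 0 would give P₃ = q - (q - 1) = 1, contradicting
  -- `hN1`.
  have hεr : ε = 1 ∨ ε = -1 ∧ (q : ℚ) ≤ r := by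
    refine hε1.imp_right fun h => ⟨h, ?_⟩
    rcases Nat.eq_zero_or_pos l with h0 | h0
    · rw [hP₃', h, hr, h0] at hN1
      norm_num at hN1
    · exact le_self_pow₀ (by linarith) h0.ne'
  have hQpos : 0 < Q₂ := by
    rw [hQ₂']
    have : 0 < q * r ^ 2 - ε * r := by
      rcases hε1 with h | h <;> rw [h] <;> nlinarith
    exact mul_pos (by linarith) this
  have hinj := symbolRate_injective hQ3 hr1 hεr
  have hn : ∀ k, ({x : Ru K | pairType (ZMod q) x = k}.ncard : ℚ) =
      ![1, 2 * (P₃ - 1), 2 * Q₂, (P₃ - 1) ^ 2, 2 * Q₂ * (P₃ - 1), Q₂ ^ 2] k := by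
    intro k
    rw [ncard_pairType_eq]
    fin_cases k <;> (simp [n1, n2]; try ring)
  have hnpos : ∀ k, {x : Ru K | pairType (ZMod q) x = k}.ncard ≠ 0 := by
    intro k
    have hP : 0 < P₃ - 1 := by linarith
    have : (0 : ℚ) < ({x : Ru K | pairType (ZMod q) x = k}.ncard : ℚ) := by
      rw [hn]
      generalize P₃ - 1 = p at hP
      fin_cases k <;> dsimp <;> positivity
    exact_mod_cast this.ne'
  -- One representative per class. Weights and exponents are read off from the words of these
  -- representatives, so the rational formulas are natural numbers without an integrality argument.
  choose x hx using fun k => Set.nonempty_of_ncard_ne_zero (hnpos k)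
  simp only [Set.mem_ofPred_eq] at hx
  have hlee' : ∀ y : Ru K, leeWeight (codeword (ZMod q) K y) =
      leeWeight (codeword (ZMod q) K (x (pairType (ZMod q) y))) := by
    intro y
    have : (leeWeight (codeword (ZMod q) K y) : ℚ) =
        leeWeight (codeword (ZMod q) K (x (pairType (ZMod q) y))) := by
      rw [hlee, hlee, hx]
    exact_mod_cast this
  have hfac : (q - 1 : ℚ) * (2 * r ^ 2) ≠ 0 := by
    have : (0 : ℚ) < q - 1 := by linarith
    positivity
  have hW : Function.Injective fun k => leeWeight (codeword (ZMod q) K (x k)) := by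
    intro i j hij
    have : (leeWeight (codeword (ZMod q) K (x i)) : ℚ) = leeWeight (codeword (ZMod q) K (x j)) := by
      exact_mod_cast hij
    rw [hlee, hlee, hx, hx] at this
    exact hinj (mul_left_cancel₀ hfac (by linear_combination this))
  have hW0 : leeWeight (codeword (ZMod q) K (x 0)) = 0 := by
    have : (leeWeight (codeword (ZMod q) K (x 0)) : ℚ) = 0 := by
      rw [hlee, hx]
      simp [symbolRate]
    exact_mod_cast this
  -- Distinct weights put y in the class of weight 0, which contains only 0.
  have hzero : ∀ y : Ru K, leeWeight (codeword (ZMod q) K y) = 0 → y = 0 := by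
    intro y hy
    rw [hlee', ← hW0] at hy
    exact (pairType_eq_zero_iff y).mp (hW hy)
  have hcinj := codeword_injective hzero
  have hcount := leeCount_code hcinj hW hlee'
  -- The symbol 1 stands for an arbitrary nonzero symbol in the exponents `e`.
  refine ⟨?_, ⟨fun i => leeWeight (codeword (ZMod q) K (x i.succ)), ?_, ?_, ?_, ?_, ?_, ?_, ?_⟩,
    ⟨fun k => comp (gray (codeword (ZMod q) K (x k))) 0,
      fun k => comp (gray (codeword (ZMod q) K (x k))) 1, ?_, ?_, ?_⟩⟩
  · have := code_free_finrank hcinj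
    rwa [hfr] at this
  · exact hW.comp (Fin.succ_injective 5)
  · intro i h
    exact Fin.succ_ne_zero i (hW (h.trans hW0.symm))
  · intro i
    rw [hlee, hx]
    exact lee_weights hQ0 hG' i
  · exact leeCount_code_zero hzero
  · intro i
    rw [hcount]
    exact hnpos _
  · intro i
    rw [hcount, hn, hP₃, hQ₂]
    fin_cases i <;> dsimp <;> ring
  · intro v hv hvw
    refine leeCount_code_eq_zero (W := fun k => leeWeight (codeword (ZMod q) K (x k))) hlee'
      fun k => ?_
    refine Fin.cases ?_ (fun i => hvw i) k
    rwa [hW0]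
  · intro k
    rw [hcomp, if_pos rfl, hx]
    exact zero_exponents hQ0 hε2 hG' hP₂ hP₃' hQ₃ k
  · intro k
    rw [hcomp, if_neg one_ne_zero, hx, add_zero]
    exact symbol_exponents hQ0 hG' hP₂ hQ₃ k
  · rw [completeWeightEnumerator_code hcinj (T := pairType (ZMod q))
      (e₀ := fun k => comp (gray (codeword (ZMod q) K (x k))) 0)
      (e := fun k => comp (gray (codeword (ZMod q) K (x k))) 1)]
    · exact Finset.sum_congr rfl fun k _ => by rw [hn]
    · intro y
      have : (comp (gray (codeword (ZMod q) K y)) 0 : ℚ) =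
          comp (gray (codeword (ZMod q) K (x (pairType (ZMod q) y)))) 0 := by
        rw [hcomp, hcomp, hx]
      exact_mod_cast this
    · intro y s hs
      have : (comp (gray (codeword (ZMod q) K y)) s : ℚ) =
          comp (gray (codeword (ZMod q) K (x (pairType (ZMod q) y)))) 1 := by
        rw [hcomp, hcomp, hx, if_neg hs, if_neg one_ne_zero]
      exact_mod_cast this
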